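/- **Corollary (Logical Soundness of unannotated $T_{\mathrm{vec}}$).** There is a type $\phi$ of unannotated $T_{\mathrm{vec}}$ such that $\cdot\vdash a:\phi$ holds for no term $a$, where $\cdot$ is the empty context. In particular, $\cdot\vdash a:(0 = S\,0)$ holds for no term $a$. Here unannotated $T_{\mathrm{vec}}$ is the following system; everything is taken up to renaming of bound variables, and $[b/x]$ is capture-avoiding substitution. *Terms and types.* $$a ::= x \mid (a\ a') \mid \lambda x.a \mid 0 \mid (S\ a) \mid (R_{\mathsf{nat}}\ a\ a'\ a'') \mid \mathsf{nil} \mid (\mathsf{cons}\ a\ a') \mid (R_{\mathsf{vec}}\ a\ a'\ a'') \mid \mathsf{join}$$ $$\phi ::= \mathsf{nat} \mid \langle\mathsf{vec}\ \phi\ a\rangle \mid \Pi x{:}\phi.\phi' \mid \forall x{:}\phi.\phi' \mid a = a'$$ *Reduction* $\leadsto$ is the compatible closure, under arbitrary contexts, of $$(\lambda x.a)\ a' \leadsto [a'/x]a,\qquad (R_{\mathsf{nat}}\ a\ a'\ 0)\leadsto a,\qquad (R_{\mathsf{nat}}\ a\ a'\ (S\ a''))\leadsto (a'\ a''\ (R_{\mathsf{nat}}\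 a\ a'\ a'')),$$ $$(R_{\mathsf{vec}}\ a\ a'\ \mathsf{nil})\leadsto a,\qquad (R_{\mathsf{vec}}\ a\ a'\ (\mathsf{cons}\ a_1\ a''))\leadsto (a'\ a_1\ a''\ (R_{\mathsf{vec}}\ a\ a'\ a'')).$$ We write $a\downarrow a'$ if there is $\hat a$ with $a\leadsto^*\hat a$ and $a'\leadsto^*\hat a$. *Contexts* $\Gamma$ are finite sequences of declarations $x:\phi$ of distinct variables. $\Gamma\ \mathit{Ok}$ means that $\mathrm{FV}(\phi)\subseteq\mathrm{dom}(\Gamma_1)$ whenever $\Gamma\equiv\Gamma_1,x{:}\phi,\Gamma_2$. Well-formedness of types is not otherwise tracked. *Typing* $\Gamma\vdash a:\phi$ is the least relation closed under the following rules (premises before $\Rightarrow$). - (var) $\Gamma(x)\equiv\phi$ and $\Gamma\ \mathit{Ok}$ $\Rightarrow$ $\Gamma\vdash x:\phi$. - (join) $a\downarrow a'$ and $\Gamma\ \mathit{Ok}$ $\Rightarrow$ $\Gamma\vdash\mathsf{join}:a=a'$. - (conv) $\Gamma\vdash a''':a'=a''$, $\Gamma\vdash a:[a'/x]\phi$ and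 $x\notin\mathrm{dom}(\Gamma)$ $\Rightarrow$ $\Gamma\vdash a:[a''/x]\phi$. - (spec-abs) $\Gamma,x{:}\phi'\vdash a:\phi$ and $x\notin\mathrm{FV}(a)$ $\Rightarrow$ $\Gamma\vdash a:\forall x{:}\phi'.\phi$. - (spec-app) $\Gamma\vdash a:\forall x{:}\phi'.\phi$ and $\Gamma\vdash a':\phi'$ $\Rightarrow$ $\Gamma\vdash a:[a'/x]\phi$. - (abs) $\Gamma,x{:}\phi'\vdash a:\phi$ $\Rightarrow$ $\Gamma\vdash\lambda x.a:\Pi x{:}\phi'.\phi$. - (app) $\Gamma\vdash a:\Pi x{:}\phi'.\phi$ and $\Gamma\vdash a':\phi'$ $\Rightarrow$ $\Gamma\vdash(a\ a'):[a'/x]\phi$. - (zero) $\Gamma\ \mathit{Ok}$ $\Rightarrow$ $\Gamma\vdash 0:\mathsf{nat}$. - (nil) $\Gamma\ \mathit{Ok}$ $\Rightarrow$ $\Gamma\vdash\mathsf{nil}:\langle\mathsf{vec}\ \phi\ 0\rangle$. - (succ) $\Gamma\vdash a:\mathsf{nat}$ $\Rightarrow$ $\Gamma\vdash(S\ a):\mathsf{nat}$.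 - (Rnat) $\Gamma\vdash a'':\mathsf{nat}$, $\Gamma\vdash a:[0/x]\phi$, $\Gamma\vdash a':\Pi y{:}\mathsf{nat}.\,\Pi u{:}[y/x]\phi.\,[(S\,y)/x]\phi$ and $x\notin\mathrm{dom}(\Gamma)$ $\Rightarrow$ $\Gamma\vdash(R_{\mathsf{nat}}\ a\ a'\ a''):[a''/x]\phi$. - (cons) $\Gamma\vdash a:\phi$ and $\Gamma\vdash a':\langle\mathsf{vec}\ \phi\ l\rangle$ $\Rightarrow$ $\Gamma\vdash(\mathsf{cons}\ a\ a'):\langle\mathsf{vec}\ \phi\ (S\ l)\rangle$. - (Rvec) $\Gamma\vdash a'':\langle\mathsf{vec}\ \phi'\ l\rangle$, $\Gamma\vdash a:[0/y,\mathsf{nil}/x]\phi$, $\Gamma\vdash a':\Pi z{:}\phi'.\,\forall m{:}\mathsf{nat}.\,\Pi v{:}\langle\mathsf{vec}\ \phi'\ m\rangle.\,\Pi u{:}[m/y,v/x]\phi.\,[(S\ m)/y,(\mathsf{cons}\ z\ v)/x]\phi$ and $x,y\notin\mathrm{dom}(\Gamma)$ distinct $\Rightarrow$ $\Gamma\vdash(R_{\mathsf{vec}}\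 a\ a'\ a''):[l/y,a''/x]\phi$. In (Rnat) and (Rvec) the variables bound by the displayed quantifiers are chosen fresh. -/

import Mathlib

namespace Tvec

/-- Unannotated terms, up to renaming of bound variables: variables are de Bruijn indices, and
`lam a` binds index `0` of `a`. -/
inductive Tm : Type
  | var (n : ℕ)
  | app (a b : Tm)
  | lam (a : Tm)
  | zero
  | succ (a : Tm)
  | natRec (a b c : Tm)
  | nil
  | cons (a b : Tm)
  | vecRec (a b c : Tm)
  | join

/-- Types. In `pi φ ψ` (the product `Π x : φ. ψ`) and in `all φ ψ` (the intersection
`∀ x : φ. ψ`), index `0` of `ψ` is the bound variable; `eq a b` is the type `a = b`. -/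
inductive Ty : Type
  | nat
  | vec (φ : Ty) (l : Tm)
  | pi (φ ψ : Ty)
  | all (φ ψ : Ty)
  | eq (a b : Tm)

/-- Extends a renaming under a binder. -/
def liftRen (ρ : ℕ → ℕ) : ℕ → ℕ
  | 0 => 0
  | n + 1 => ρ n + 1

/-- Renaming of the free variables of a term. -/
def Tm.rename : (ℕ → ℕ) → Tm → Tm
  | ρ, .var n => .var (ρ n)
  | ρ, .app a b => .app (a.rename ρ) (b.rename ρ)
  | ρ, .lam a => .lam (a.rename (liftRen ρ))
  | _, .zero => .zero
  | ρ, .succ a => .succ (a.rename ρ)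
  | ρ, .natRec a b c => .natRec (a.rename ρ) (b.rename ρ) (c.rename ρ)
  | _, .nil => .nil
  | ρ, .cons a b => .cons (a.rename ρ) (b.rename ρ)
  | ρ, .vecRec a b c => .vecRec (a.rename ρ) (b.rename ρ) (c.rename ρ)
  | _, .join => .join

/-- The simultaneous substitution that sends index `0` to `a` and index `n + 1` to `σ n`. -/
def scons (a : Tm) (σ : ℕ → Tm) : ℕ → Tm
  | 0 => a
  | n + 1 => σ n

/-- Extends a substitution under a binder. -/
def liftSub (σ : ℕ → Tm) : ℕ → Tm :=
  scons (.var 0) (fun n => (σ n).rename (· + 1))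

/-- Capture-avoiding simultaneous substitution in a term. -/
def Tm.subst : (ℕ → Tm) → Tm → Tm
  | σ, .var n => σ n
  | σ, .app a b => .app (a.subst σ) (b.subst σ)
  | σ, .lam a => .lam (a.subst (liftSub σ))
  | _, .zero => .zero
  | σ, .succ a => .succ (a.subst σ)
  | σ, .natRec a b c => .natRec (a.subst σ) (b.subst σ) (c.subst σ)
  | _, .nil => .nil
  | σ, .cons a b => .cons (a.subst σ) (b.subst σ)
  | σ, .vecRec a b c => .vecRec (a.subst σ) (b.subst σ) (c.subst σ)
  | _, .join => .join

/-- Renaming of the free variables of a type. -/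
def Ty.rename : (ℕ → ℕ) → Ty → Ty
  | _, .nat => .nat
  | ρ, .vec φ l => .vec (φ.rename ρ) (l.rename ρ)
  | ρ, .pi φ ψ => .pi (φ.rename ρ) (ψ.rename (liftRen ρ))
  | ρ, .all φ ψ => .all (φ.rename ρ) (ψ.rename (liftRen ρ))
  | ρ, .eq a b => .eq (a.rename ρ) (b.rename ρ)

/-- Capture-avoiding simultaneous substitution of terms in a type. -/
def Ty.subst : (ℕ → Tm) → Ty → Ty
  | _, .nat => .nat
  | σ, .vec φ l => .vec (φ.subst σ) (l.subst σ)
  | σ, .pi φ ψ => .pi (φ.subst σ) (ψ.subst (liftSub σ))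
  | σ, .all φ ψ => .all (φ.subst σ) (ψ.subst (liftSub σ))
  | σ, .eq a b => .eq (a.subst σ) (b.subst σ)

/-- `[b/x]a`, where `x` is index `0` of `a`; the other indices move down by one. -/
def Tm.inst (a b : Tm) : Tm := a.subst (scons b .var)

/-- `[b/x]φ`, where `x` is index `0` of `φ`; the other indices move down by one. -/
def Ty.inst (φ : Ty) (b : Tm) : Ty := φ.subst (scons b .var)

/-- One-step reduction: the compatible closure, under arbitrary contexts, of β-reduction and the
computation rules of the two recursors. -/
inductive Step : Tm → Tm → Prop
  | beta (a b : Tm) : Step (.app (.lam a) b) (a.inst b)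
  | natRec_zero (a b : Tm) : Step (.natRec a b .zero) a
  | natRec_succ (a b c : Tm) :
      Step (.natRec a b (.succ c)) (.app (.app b c) (.natRec a b c))
  | vecRec_nil (a b : Tm) : Step (.vecRec a b .nil) a
  | vecRec_cons (a b d c : Tm) :
      Step (.vecRec a b (.cons d c)) (.app (.app (.app b d) c) (.vecRec a b c))
  | app_left {a a' : Tm} (b : Tm) : Step a a' → Step (.app a b) (.app a' b)
  | app_right (a : Tm) {b b' : Tm} : Step b b' → Step (.app a b) (.app a b')
  | lam {a a' : Tm} : Step a a' → Step (.lam a) (.lam a')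
  | succ {a a' : Tm} : Step a a' → Step (.succ a) (.succ a')
  | natRec₁ {a a' : Tm} (b c : Tm) : Step a a' → Step (.natRec a b c) (.natRec a' b c)
  | natRec₂ (a : Tm) {b b' : Tm} (c : Tm) : Step b b' → Step (.natRec a b c) (.natRec a b' c)
  | natRec₃ (a b : Tm) {c c' : Tm} : Step c c' → Step (.natRec a b c) (.natRec a b c')
  | cons_left {a a' : Tm} (b : Tm) : Step a a' → Step (.cons a b) (.cons a' b)
  | cons_right (a : Tm) {b b' : Tm} : Step b b' → Step (.cons a b) (.cons a b')
  | vecRec₁ {a a' : Tm} (b c : Tm) : Step a a' → Step (.vecRec a b c) (.vecRec a' b c)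
  | vecRec₂ (a : Tm) {b b' : Tm} (c : Tm) : Step b b' → Step (.vecRec a b c) (.vecRec a b' c)
  | vecRec₃ (a b : Tm) {c c' : Tm} : Step c c' → Step (.vecRec a b c) (.vecRec a b c')

/-- `a ↓ b`: the terms `a` and `b` reduce, in finitely many steps, to a common term. -/
def Joinable (a b : Tm) : Prop := Relation.Join (Relation.ReflTransGen Step) a b

/-- Free variables of a term. -/
def Tm.fv : Tm → Set ℕ
  | .var n => {n}
  | .app a b => a.fv ∪ b.fv
  | .lam a => {n | n + 1 ∈ a.fv}
  | .zero => ∅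
  | .succ a => a.fv
  | .natRec a b c => a.fv ∪ b.fv ∪ c.fv
  | .nil => ∅
  | .cons a b => a.fv ∪ b.fv
  | .vecRec a b c => a.fv ∪ b.fv ∪ c.fv
  | .join => ∅

/-- Free variables of a type. -/
def Ty.fv : Ty → Set ℕ
  | .nat => ∅
  | .vec φ l => φ.fv ∪ l.fv
  | .pi φ ψ => φ.fv ∪ {n | n + 1 ∈ ψ.fv}
  | .all φ ψ => φ.fv ∪ {n | n + 1 ∈ ψ.fv}
  | .eq a b => a.fv ∪ b.fv

/-- A context, with the most recent declaration first: `Γ, x : φ` is `φ :: Γ`, and index `n`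
refers to the entry at position `n`, which is a type over the entries behind it. The indices
`n ≥ Γ.length` are the variables that `Γ` does not declare. -/
abbrev Ctx : Type := List Ty

/-- `Γ Ok`: the free variables of each entry are declared before it. -/
def Ctx.Ok : Ctx → Prop
  | [] => True
  | φ :: Γ => (∀ n ∈ φ.fv, n < Γ.length) ∧ Ctx.Ok Γ

/-- `Lookup Γ n φ`: the variable `n` is declared with type `φ` in `Γ`, that is `Γ(n) = φ`, where
`φ` is read over the whole of `Γ`. -/
inductive Lookup : Ctx → ℕ → Ty → Prop
  | here (Γ : Ctx) (φ : Ty) : Lookup (φ :: Γ) 0 (φ.rename (· + 1))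
  | there {Γ : Ctx} {n : ℕ} {φ : Ty} (ψ : Ty) :
      Lookup Γ n φ → Lookup (ψ :: Γ) (n + 1) (φ.rename (· + 1))

/-- The type of the step argument of the recursor on numbers with motive `x. φ`, where `x` is
index `0` of `φ`: `Π y : nat. Π u : [y/x]φ. [S y/x]φ`. -/
def natStepTy (φ : Ty) : Ty :=
  .pi .nat <|
  .pi (φ.subst (scons (.var 0) (fun n => .var (n + 1)))) <|
  φ.subst (scons (.succ (.var 1)) (fun n => .var (n + 2)))

/-- The type of the step argument of the recursor on vectors with entries of type `ψ` and motive
`y. x. φ`, where `x` is index `0` and `y` is index `1` of `φ`: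
`Π z : ψ. ∀ l : nat. Π v : ⟨vec ψ l⟩. Π u : [l/y, v/x]φ. [S l/y, cons z v/x]φ`. -/
def vecStepTy (ψ φ : Ty) : Ty :=
  .pi ψ <|
  .all .nat <|
  .pi (.vec (ψ.rename (· + 2)) (.var 0)) <|
  .pi (φ.subst (scons (.var 0) (scons (.var 1) (fun n => .var (n + 3))))) <|
  φ.subst (scons (.cons (.var 3) (.var 1)) (scons (.succ (.var 2)) (fun n => .var (n + 4))))

/-- The typing judgment `Γ ⊢ a : φ` of unannotated `T_vec`. A type `φ` with a distinguished
variable outside the domain of `Γ` (rules `conv`, `natRec`, `vecRec`) has that variable as its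
index `0`; in `vecRec` the second distinguished variable, for the length, is index `1`. -/
inductive Typing : Ctx → Tm → Ty → Prop
  | var {Γ : Ctx} {n : ℕ} {φ : Ty} : Lookup Γ n φ → Γ.Ok → Typing Γ (.var n) φ
  | join {Γ : Ctx} {a b : Tm} : Joinable a b → Γ.Ok → Typing Γ .join (.eq a b)
  | conv {Γ : Ctx} {a b b' c : Tm} {φ : Ty} :
      Typing Γ c (.eq b b') → Typing Γ a (φ.inst b) → Typing Γ a (φ.inst b')
  /- The variable bound by `∀` is not free in the subject: the subject of the premise is the
  weakening of `a`. -/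
  | specAbs {Γ : Ctx} {a : Tm} {φ ψ : Ty} :
      Typing (φ :: Γ) (a.rename (· + 1)) ψ → Typing Γ a (.all φ ψ)
  | specApp {Γ : Ctx} {a b : Tm} {φ ψ : Ty} :
      Typing Γ a (.all φ ψ) → Typing Γ b φ → Typing Γ a (ψ.inst b)
  | abs {Γ : Ctx} {a : Tm} {φ ψ : Ty} :
      Typing (φ :: Γ) a ψ → Typing Γ (.lam a) (.pi φ ψ)
  | app {Γ : Ctx} {a b : Tm} {φ ψ : Ty} :
      Typing Γ a (.pi φ ψ) → Typing Γ b φ → Typing Γ (.app a b) (ψ.inst b)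
  | zero {Γ : Ctx} : Γ.Ok → Typing Γ .zero .nat
  | nil {Γ : Ctx} {φ : Ty} : Γ.Ok → Typing Γ .nil (.vec φ .zero)
  | succ {Γ : Ctx} {a : Tm} : Typing Γ a .nat → Typing Γ (.succ a) .nat
  | natRec {Γ : Ctx} {a b c : Tm} {φ : Ty} :
      Typing Γ c .nat →
      Typing Γ a (φ.inst .zero) →
      Typing Γ b (natStepTy φ) →
      Typing Γ (.natRec a b c) (φ.inst c)
  | cons {Γ : Ctx} {a b l : Tm} {φ : Ty} :
      Typing Γ a φ → Typing Γ b (.vec φ l) → Typing Γ (.cons a b) (.vec φ (.succ l))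
  | vecRec {Γ : Ctx} {a b c l : Tm} {ψ φ : Ty} :
      Typing Γ c (.vec ψ l) →
      Typing Γ a (φ.subst (scons .nil (scons .zero .var))) →
      Typing Γ b (vecStepTy ψ φ) →
      Typing Γ (.vecRec a b c) (φ.subst (scons c (scons l .var)))

end Tvec

namespace Tvec

/-! ### Renaming and substitution -/

/-! The proof is a realizability model on untyped, possibly open terms. `Ty.Realizes` reads a type,
under an assignment of terms to its variables, as a set of terms: products by application,
intersections with the subject unchanged, and an equation as all terms or none, according to whether
its sides are convertible. Every such set is closed under conversion of both subject and assignment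
(`Ty.Realizes.conv`), which validates the rule `conv` and the computation rules. Hence typable terms
realize their types (`Typing.realizes`), and an inhabitant of `0 = S 0` would make `0` and `S 0`
convertible. Normalization plays no role. Confluence makes convertibility transitive;
`not_conv_zero_succ` needs only that reduction preserves the constructors `0` and `S`. -/

theorem liftRen_comp (ρ ρ' : ℕ → ℕ) :
    (fun n => liftRen ρ' (liftRen ρ n)) = liftRen (fun n => ρ' (ρ n)) := by
  funext n; cases n <;> rfl

theorem liftSub_liftRen (ρ : ℕ → ℕ) (σ : ℕ → Tm) :
    (fun n => liftSub σ (liftRen ρ n)) = liftSub (fun n => σ (ρ n)) := by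
  funext n; cases n <;> rfl

theorem scons_liftRen (b : Tm) (ρ : ℕ → ℕ) (σ : ℕ → Tm) :
    (fun n => scons b σ (liftRen ρ n)) = scons b (fun n => σ (ρ n)) := by
  funext n; cases n <;> rfl

theorem Tm.rename_rename (a : Tm) (ρ ρ' : ℕ → ℕ) :
    (a.rename ρ).rename ρ' = a.rename (fun n => ρ' (ρ n)) := by
  induction a generalizing ρ ρ' <;> simp_all [Tm.rename, liftRen_comp]

theorem Tm.subst_rename (a : Tm) (ρ : ℕ → ℕ) (σ : ℕ → Tm) :
    (a.rename ρ).subst σ = a.subst (fun n => σ (ρ n)) := by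
  induction a generalizing ρ σ <;> simp_all [Tm.rename, Tm.subst, liftSub_liftRen]

theorem rename_liftSub (σ : ℕ → Tm) (ρ : ℕ → ℕ) :
    (fun n => (liftSub σ n).rename (liftRen ρ)) = liftSub (fun n => (σ n).rename ρ) := by
  funext n
  cases n with
  | zero => rfl
  | succ n => simp [liftSub, scons, Tm.rename_rename, liftRen]

theorem Tm.rename_subst (a : Tm) (σ : ℕ → Tm) (ρ : ℕ → ℕ) :
    (a.subst σ).rename ρ = a.subst (fun n => (σ n).rename ρ) := by
  induction a generalizing σ ρ <;> simp_all [Tm.rename, Tm.subst, rename_liftSub]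

theorem subst_liftSub (σ τ : ℕ → Tm) :
    (fun n => (liftSub σ n).subst (liftSub τ)) = liftSub (fun n => (σ n).subst τ) := by
  funext n
  cases n with
  | zero => rfl
  | succ n => simp [liftSub, scons, Tm.rename_subst, Tm.subst_rename]

theorem Tm.subst_subst (a : Tm) (σ τ : ℕ → Tm) :
    (a.subst σ).subst τ = a.subst (fun n => (σ n).subst τ) := by
  induction a generalizing σ τ <;> simp_all [Tm.subst, subst_liftSub]

theorem liftSub_var : liftSub .var = .var := by
  funext n; cases n <;> rfl

theorem Tm.subst_var (a : Tm) : a.subst .var = a := by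
  induction a <;> simp_all [Tm.subst, liftSub_var]

theorem subst_liftSub_scons (b : Tm) (σ τ : ℕ → Tm) :
    (fun n => (liftSub σ n).subst (scons b τ)) = scons b (fun n => (σ n).subst τ) := by
  funext n
  cases n with
  | zero => rfl
  | succ n => simp [liftSub, scons, Tm.subst_rename]

theorem subst_scons (b : Tm) (σ τ : ℕ → Tm) :
    (fun n => (scons b σ n).subst τ) = scons (b.subst τ) (fun n => (σ n).subst τ) := by
  funext n; cases n <;> rfl

theorem Tm.inst_subst_liftSub (a b : Tm) (σ : ℕ → Tm) :
    (a.subst (liftSub σ)).inst b = a.subst (scons b σ) := by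
  simp [Tm.inst, Tm.subst_subst, subst_liftSub_scons, Tm.subst_var]

theorem Tm.subst_inst (a b : Tm) (σ : ℕ → Tm) :
    (a.inst b).subst σ = (a.subst (liftSub σ)).inst (b.subst σ) := by
  rw [Tm.inst_subst_liftSub, Tm.inst, Tm.subst_subst, subst_scons]
  rfl

theorem Tm.rename_inst (a b : Tm) (ρ : ℕ → ℕ) :
    (a.inst b).rename ρ = (a.rename (liftRen ρ)).inst (b.rename ρ) := by
  rw [Tm.inst, Tm.inst, Tm.rename_subst, Tm.subst_rename]
  congr 1
  funext n; cases n <;> rfl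

/-! ### Parallel reduction and confluence -/

/-- Parallel reduction. -/
inductive Par : Tm → Tm → Prop
  | var (n : ℕ) : Par (.var n) (.var n)
  | app {a a' b b' : Tm} : Par a a' → Par b b' → Par (.app a b) (.app a' b')
  | lam {a a' : Tm} : Par a a' → Par (.lam a) (.lam a')
  | zero : Par .zero .zero
  | succ {a a' : Tm} : Par a a' → Par (.succ a) (.succ a')
  | natRec {a a' b b' c c' : Tm} :
      Par a a' → Par b b' → Par c c' → Par (.natRec a b c) (.natRec a' b' c')
  | nil : Par .nil .nil
  | cons {a a' b b' : Tm} : Par a a' → Par b b' → Par (.cons a b) (.cons a' b')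
  | vecRec {a a' b b' c c' : Tm} :
      Par a a' → Par b b' → Par c c' → Par (.vecRec a b c) (.vecRec a' b' c')
  | join : Par .join .join
  | beta {a a' b b' : Tm} : Par a a' → Par b b' → Par (.app (.lam a) b) (a'.inst b')
  | natRec_zero {a a' : Tm} (b : Tm) : Par a a' → Par (.natRec a b .zero) a'
  | natRec_succ {a a' b b' c c' : Tm} : Par a a' → Par b b' → Par c c' →
      Par (.natRec a b (.succ c)) (.app (.app b' c') (.natRec a' b' c'))
  | vecRec_nil {a a' : Tm} (b : Tm) : Par a a' → Par (.vecRec a b .nil) a'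
  | vecRec_cons {a a' b b' c c' d d' : Tm} : Par a a' → Par b b' → Par c c' → Par d d' →
      Par (.vecRec a b (.cons d c)) (.app (.app (.app b' d') c') (.vecRec a' b' c'))

theorem Par.refl (a : Tm) : Par a a := by
  induction a <;> constructor <;> assumption

theorem Step.par {a b : Tm} (h : Step a b) : Par a b := by
  induction h <;> constructor <;> first | assumption | exact Par.refl _

theorem Par.rename {a b : Tm} (h : Par a b) (ρ : ℕ → ℕ) : Par (a.rename ρ) (b.rename ρ) := by
  induction h generalizing ρ with
  | beta _ _ iha ihb => rw [Tm.rename_inst]; exact .beta (iha _) (ihb _)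
  | natRec_zero _ _ ih => exact .natRec_zero _ (ih _)
  | vecRec_nil _ _ ih => exact .vecRec_nil _ (ih _)
  | natRec_succ _ _ _ iha ihb ihc => exact .natRec_succ (iha _) (ihb _) (ihc _)
  | vecRec_cons _ _ _ _ iha ihb ihc ihd => exact .vecRec_cons (iha _) (ihb _) (ihc _) (ihd _)
  | var n => exact .var _
  | _ => constructor <;> apply_assumption

theorem Par.liftSub {σ τ : ℕ → Tm} (h : ∀ n, Par (σ n) (τ n)) (n : ℕ) :
    Par (liftSub σ n) (liftSub τ n) := by
  cases n with
  | zero => exact .var 0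
  | succ n => exact (h n).rename _

theorem Par.subst {a b : Tm} (h : Par a b) {σ τ : ℕ → Tm} (hστ : ∀ n, Par (σ n) (τ n)) :
    Par (a.subst σ) (b.subst τ) := by
  induction h generalizing σ τ with
  | beta _ _ iha ihb => rw [Tm.subst_inst]; exact .beta (iha (.liftSub hστ)) (ihb hστ)
  | natRec_zero _ _ ih => exact .natRec_zero _ (ih hστ)
  | vecRec_nil _ _ ih => exact .vecRec_nil _ (ih hστ)
  | natRec_succ _ _ _ iha ihb ihc => exact .natRec_succ (iha hστ) (ihb hστ) (ihc hστ)
  | vecRec_cons _ _ _ _ iha ihb ihc ihd =>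
    exact .vecRec_cons (iha hστ) (ihb hστ) (ihc hστ) (ihd hστ)
  | var n => exact hστ n
  | lam _ ih => exact .lam (ih (.liftSub hστ))
  | app _ _ iha ihb => exact .app (iha hστ) (ihb hστ)
  | zero => exact .zero
  | succ _ ih => exact .succ (ih hστ)
  | natRec _ _ _ iha ihb ihc => exact .natRec (iha hστ) (ihb hστ) (ihc hστ)
  | nil => exact .nil
  | cons _ _ iha ihb => exact .cons (iha hστ) (ihb hστ)
  | vecRec _ _ _ iha ihb ihc => exact .vecRec (iha hστ) (ihb hστ) (ihc hστ)
  | join => exact .join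

theorem Par.inst {a a' b b' : Tm} (ha : Par a a') (hb : Par b b') :
    Par (a.inst b) (a'.inst b') :=
  ha.subst fun n => by cases n with
    | zero => exact hb
    | succ n => exact .var n

/-- The complete development of a term: all its redexes are contracted at once. -/
def Tm.develop : Tm → Tm
  | .var n => .var n
  | .app (.lam a) b => a.develop.inst b.develop
  | .app a b => .app a.develop b.develop
  | .lam a => .lam a.develop
  | .zero => .zero
  | .succ a => .succ a.develop
  | .natRec a _ .zero => a.develop
  | .natRec a b (.succ c) =>
      .app (.app b.develop c.develop) (.natRec a.develop b.develop c.develop)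
  | .natRec a b c => .natRec a.develop b.develop c.develop
  | .nil => .nil
  | .cons a b => .cons a.develop b.develop
  | .vecRec a _ .nil => a.develop
  | .vecRec a b (.cons d c) =>
      .app (.app (.app b.develop d.develop) c.develop) (.vecRec a.develop b.develop c.develop)
  | .vecRec a b c => .vecRec a.develop b.develop c.develop
  | .join => .join

/-- Takahashi's triangle property: a redex that a parallel step leaves alone survives it and can be
contracted next. The target depends on `a` only, so it closes every span out of `a`. -/
theorem Par.develop {a b : Tm} (h : Par a b) : Par b a.develop := by
  induction h with
  | var n => exact .var n
  | zero => exact .zero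
  | nil => exact .nil
  | join => exact .join
  | lam _ ih => exact .lam ih
  | succ _ ih => exact .succ ih
  | cons _ _ iha ihb => exact .cons iha ihb
  | @app a a' b b' ha hb iha ihb =>
    -- An abstraction steps only to an abstraction, so inverting `ha` and `iha` exposes the redex
    -- that the development contracts.
    cases a with
    | lam a =>
      cases ha with
      | lam ha => cases iha with
        | lam iha => exact .beta iha ihb
    | _ => exact .app iha ihb
  | @natRec a a' b b' c c' ha hb hc iha ihb ihc =>
    cases c with
    | zero => cases hc; exact .natRec_zero _ iha
    | succ c =>
      cases hc with
      | succ hc => cases ihc with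
        | succ ihc => exact .natRec_succ iha ihb ihc
    | _ => exact .natRec iha ihb ihc
  | @vecRec a a' b b' c c' ha hb hc iha ihb ihc =>
    cases c with
    | nil => cases hc; exact .vecRec_nil _ iha
    | cons d c =>
      cases hc with
      | cons hd hc => cases ihc with
        | cons ihd ihc => exact .vecRec_cons iha ihb ihc ihd
    | _ => exact .vecRec iha ihb ihc
  | beta _ _ iha ihb => exact iha.inst ihb
  | natRec_zero _ _ ih => exact ih
  | vecRec_nil _ _ ih => exact ih
  | natRec_succ _ _ _ iha ihb ihc => exact .app (.app ihb ihc) (.natRec iha ihb ihc)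
  | vecRec_cons _ _ _ _ iha ihb ihc ihd =>
    exact .app (.app (.app ihb ihd) ihc) (.vecRec iha ihb ihc)

/-! ### Convertibility -/

/-- Convertibility: having a common reduct under parallel reduction. -/
def Conv (a b : Tm) : Prop := Relation.Join (Relation.ReflTransGen Par) a b

/-- Transitivity is the Church-Rosser property; the complete development supplies the diamond. -/
theorem conv_equivalence : Equivalence Conv :=
  Relation.equivalence_join_reflTransGen fun a _ _ hb hc =>
    ⟨a.develop, .single hb.develop, .single hc.develop⟩

theorem Conv.refl (a : Tm) : Conv a a := conv_equivalence.refl a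

theorem Conv.symm {a b : Tm} (h : Conv a b) : Conv b a := conv_equivalence.symm h

theorem Conv.trans {a b c : Tm} (h : Conv a b) (h' : Conv b c) : Conv a c :=
  conv_equivalence.trans h h'

theorem Par.conv {a b : Tm} (h : Par a b) : Conv a b := ⟨b, .single h, .refl⟩

theorem Step.conv {a b : Tm} (h : Step a b) : Conv a b := h.par.conv

theorem Joinable.conv {a b : Tm} : Joinable a b → Conv a b := fun ⟨c, hac, hbc⟩ =>
  ⟨c, hac.lift id fun _ _ => Step.par, hbc.lift id fun _ _ => Step.par⟩

theorem Conv.map {f : Tm → Tm} (hf : ∀ a b, Par a b → Par (f a) (f b)) {a b : Tm} :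
    Conv a b → Conv (f a) (f b) := fun ⟨c, hac, hbc⟩ => ⟨f c, hac.lift f hf, hbc.lift f hf⟩

theorem Conv.rename {a b : Tm} (h : Conv a b) (ρ : ℕ → ℕ) : Conv (a.rename ρ) (b.rename ρ) :=
  h.map fun _ _ h => h.rename ρ

theorem Conv.subst {a b : Tm} (h : Conv a b) (σ : ℕ → Tm) : Conv (a.subst σ) (b.subst σ) :=
  h.map (f := fun a => a.subst σ) fun _ _ h => h.subst fun _ => .refl _

theorem Conv.lam {a b : Tm} (h : Conv a b) : Conv (.lam a) (.lam b) := h.map fun _ _ => .lam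

theorem Conv.succ {a b : Tm} (h : Conv a b) : Conv (.succ a) (.succ b) := h.map fun _ _ => .succ

theorem Conv.app {a a' b b' : Tm} (ha : Conv a a') (hb : Conv b b') :
    Conv (.app a b) (.app a' b') :=
  (ha.map (f := fun a => .app a b) fun _ _ h => .app h (.refl _)).trans
    (hb.map fun _ _ h => .app (.refl _) h)

theorem Conv.cons {a a' b b' : Tm} (ha : Conv a a') (hb : Conv b b') :
    Conv (.cons a b) (.cons a' b') :=
  (ha.map (f := fun a => .cons a b) fun _ _ h => .cons h (.refl _)).trans
    (hb.map fun _ _ h => .cons (.refl _) h)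

theorem Conv.natRec {a a' b b' c c' : Tm} (ha : Conv a a') (hb : Conv b b') (hc : Conv c c') :
    Conv (.natRec a b c) (.natRec a' b' c') :=
  (ha.map (f := fun a => .natRec a b c) fun _ _ h => .natRec h (.refl _) (.refl _)).trans <|
    (hb.map (f := fun b => .natRec a' b c) fun _ _ h => .natRec (.refl _) h (.refl _)).trans <|
      hc.map fun _ _ h => .natRec (.refl _) (.refl _) h

theorem Conv.vecRec {a a' b b' c c' : Tm} (ha : Conv a a') (hb : Conv b b') (hc : Conv c c') :
    Conv (.vecRec a b c) (.vecRec a' b' c') :=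
  (ha.map (f := fun a => .vecRec a b c) fun _ _ h => .vecRec h (.refl _) (.refl _)).trans <|
    (hb.map (f := fun b => .vecRec a' b c) fun _ _ h => .vecRec (.refl _) h (.refl _)).trans <|
      hc.map fun _ _ h => .vecRec (.refl _) (.refl _) h

theorem Conv.scons {a b : Tm} {σ τ : ℕ → Tm} (h : Conv a b) (hστ : ∀ n, Conv (σ n) (τ n)) (n : ℕ) :
    Conv (scons a σ n) (scons b τ n) := by
  cases n with
  | zero => exact h
  | succ n => exact hστ n

/-- Infinitely many variables may change, with no common bound on the reductions, so `Conv.map` does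
not apply; induction on `a` treats each occurrence separately. -/
theorem Conv.subst_congr (a : Tm) {σ τ : ℕ → Tm} (h : ∀ n, Conv (σ n) (τ n)) :
    Conv (a.subst σ) (a.subst τ) := by
  induction a generalizing σ τ with
  | var n => exact h n
  | lam a ih => exact (ih (Conv.scons (.refl _) fun n => (h n).rename _)).lam
  | app a b iha ihb => exact (iha h).app (ihb h)
  | zero => exact .refl _
  | succ a ih => exact (ih h).succ
  | natRec a b c iha ihb ihc => exact (iha h).natRec (ihb h) (ihc h)
  | nil => exact .refl _
  | cons a b iha ihb => exact (iha h).cons (ihb h)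
  | vecRec a b c iha ihb ihc => exact (iha h).vecRec (ihb h) (ihc h)
  | join => exact .refl _

theorem not_conv_zero_succ (a : Tm) : ¬ Conv .zero (.succ a) := by
  rintro ⟨c, hz, hs⟩
  have hc : c = .zero := by
    clear hs
    induction hz with
    | refl => rfl
    | tail _ h ih => subst ih; cases h; rfl
  have hc' : ∃ b, c = .succ b := by
    clear hz hc
    induction hs with
    | refl => exact ⟨_, rfl⟩
    | tail _ h ih => obtain ⟨b, rfl⟩ := ih; cases h; exact ⟨_, rfl⟩
  obtain ⟨b, rfl⟩ := hc'
  cases hc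

/-! ### Realizability interpretation of types -/

/-- The terms convertible to a numeral. -/
inductive IsNum : Tm → Prop
  | zero {a : Tm} : Conv a .zero → IsNum a
  | succ {a b : Tm} : Conv a (.succ b) → IsNum b → IsNum a

/-- `IsVec P a l`: the term `a` is convertible to a list with entries in `P` and `l` is convertible
to the numeral of its length. -/
inductive IsVec (P : Tm → Prop) : Tm → Tm → Prop
  | nil {a l : Tm} : Conv a .nil → Conv l .zero → IsVec P a l
  | cons {a l b c m : Tm} :
      Conv a (.cons b c) → Conv l (.succ m) → P b → IsVec P c m → IsVec P a l

theorem IsNum.conv {a b : Tm} (ha : IsNum a) (h : Conv b a) : IsNum b := by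
  cases ha with
  | zero h' => exact .zero (h.trans h')
  | succ h' hn => exact .succ (h.trans h') hn

theorem IsVec.conv {P : Tm → Prop} {a b l m : Tm} (ha : IsVec P a l) (h : Conv b a)
    (hl : Conv m l) : IsVec P b m := by
  cases ha with
  | nil h₁ h₂ => exact .nil (h.trans h₁) (hl.trans h₂)
  | cons h₁ h₂ hb hc => exact .cons (h.trans h₁) (hl.trans h₂) hb hc

/-- Allows the length to instantiate `∀ m : nat` in the step type of the vector recursor. -/
theorem IsVec.isNum {P : Tm → Prop} {a l : Tm} (h : IsVec P a l) : IsNum l := by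
  induction h with
  | nil _ h => exact .zero h
  | cons _ h _ _ ih => exact .succ h ih

/-- `φ.Realizes σ a`: the term `a` realizes the type `φ` under the assignment `σ` of terms to the
free variables of `φ`. -/
def Ty.Realizes : Ty → (ℕ → Tm) → Tm → Prop
  | .nat, _, a => IsNum a
  | .vec φ l, σ, a => IsVec (φ.Realizes σ) a (l.subst σ)
  | .pi φ ψ, σ, a => ∀ b, φ.Realizes σ b → ψ.Realizes (scons b σ) (.app a b)
  | .all φ ψ, σ, a => ∀ b, φ.Realizes σ b → ψ.Realizes (scons b σ) a
  | .eq a b, σ, _ => Conv (a.subst σ) (b.subst σ)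

theorem Ty.realizes_rename (φ : Ty) (ρ : ℕ → ℕ) (σ : ℕ → Tm) :
    (φ.rename ρ).Realizes σ = φ.Realizes fun n => σ (ρ n) := by
  induction φ generalizing ρ σ with
  | nat => rfl
  | vec φ l ih => funext a; simp [Ty.rename, Ty.Realizes, Tm.subst_rename, ih]
  | pi φ ψ ihφ ihψ => funext a; simp [Ty.rename, Ty.Realizes, ihφ, ihψ, scons_liftRen]
  | all φ ψ ihφ ihψ => funext a; simp [Ty.rename, Ty.Realizes, ihφ, ihψ, scons_liftRen]
  | eq a b => funext c; simp [Ty.rename, Ty.Realizes, Tm.subst_rename]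

theorem Ty.realizes_subst (φ : Ty) (τ σ : ℕ → Tm) :
    (φ.subst τ).Realizes σ = φ.Realizes fun n => (τ n).subst σ := by
  induction φ generalizing τ σ with
  | nat => rfl
  | vec φ l ih => funext a; simp [Ty.subst, Ty.Realizes, Tm.subst_subst, ih]
  | pi φ ψ ihφ ihψ => funext a; simp [Ty.subst, Ty.Realizes, ihφ, ihψ, subst_liftSub_scons]
  | all φ ψ ihφ ihψ => funext a; simp [Ty.subst, Ty.Realizes, ihφ, ihψ, subst_liftSub_scons]
  | eq a b => funext c; simp [Ty.subst, Ty.Realizes, Tm.subst_subst]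

theorem Ty.realizes_inst (φ : Ty) (b : Tm) (σ : ℕ → Tm) :
    (φ.inst b).Realizes σ = φ.Realizes (scons (b.subst σ) σ) := by
  rw [Ty.inst, Ty.realizes_subst, subst_scons]
  rfl

theorem Ty.Realizes.conv {φ : Ty} {σ τ : ℕ → Tm} {a b : Tm} (h : φ.Realizes σ a)
    (hστ : ∀ n, Conv (τ n) (σ n)) (hab : Conv b a) : φ.Realizes τ b := by
  induction φ generalizing σ τ a b with
  | nat => exact IsNum.conv h hab
  | vec φ l ih =>
    -- The entry predicate is a parameter of `IsVec`, so the two predicates are identified outright,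
    -- using the induction hypothesis in both directions.
    have hP : φ.Realizes σ = φ.Realizes τ := funext fun c => propext
      ⟨fun hc => ih hc hστ (.refl c), fun hc => ih hc (fun n => (hστ n).symm) (.refl c)⟩
    simp only [Ty.Realizes] at h ⊢
    rw [← hP]
    exact h.conv hab (.subst_congr l hστ)
  | pi φ ψ ihφ ihψ =>
    exact fun c hc => ihψ (h c (ihφ hc (fun n => (hστ n).symm) (.refl c)))
      (Conv.scons (.refl c) hστ) (hab.app (.refl c))
  | all φ ψ ihφ ihψ =>
    exact fun c hc => ihψ (h c (ihφ hc (fun n => (hστ n).symm) (.refl c)))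
      (Conv.scons (.refl c) hστ) hab
  | eq c d => exact (Conv.subst_congr c hστ).trans (Conv.trans h (Conv.subst_congr d hστ).symm)

/-- The assignment `σ` realizes every declaration of `Γ`. -/
def Ctx.Realizes (Γ : Ctx) (σ : ℕ → Tm) : Prop :=
  ∀ n φ, Lookup Γ n φ → φ.Realizes σ (σ n)

theorem Ctx.Realizes.cons {Γ : Ctx} {σ : ℕ → Tm} (h : Γ.Realizes σ) {φ : Ty} {a : Tm}
    (ha : φ.Realizes σ a) : Ctx.Realizes (φ :: Γ) (scons a σ) := by
  intro n ψ hn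
  cases hn with
  | here => rw [Ty.realizes_rename]; exact ha
  | there _ hn => rw [Ty.realizes_rename]; exact h _ _ hn

theorem realizes_natStepTy {φ : Ty} {σ : ℕ → Tm} {b : Tm} (h : (natStepTy φ).Realizes σ b)
    {y u : Tm} (hy : IsNum y) (hu : φ.Realizes (scons y σ) u) :
    φ.Realizes (scons (.succ y) σ) (.app (.app b y) u) := by
  have := h y hy u
  simp only [Ty.realizes_subst, subst_scons] at this
  exact this hu

theorem realizes_vecStepTy {ψ φ : Ty} {σ : ℕ → Tm} {b : Tm} (h : (vecStepTy ψ φ).Realizes σ b)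
    {z l v u : Tm} (hz : ψ.Realizes σ z) (hv : IsVec (ψ.Realizes σ) v l)
    (hu : φ.Realizes (scons v (scons l σ)) u) :
    φ.Realizes (scons (.cons z v) (scons (.succ l) σ)) (.app (.app (.app b z) v) u) := by
  -- The length `l` instantiates an intersection, so it is no argument of `b`, in agreement with the
  -- reduction rule.
  have := h z hz l hv.isNum v (by simp only [Ty.Realizes, Ty.realizes_rename]; exact hv) u
  simp only [Ty.realizes_subst, subst_scons] at this
  exact this hu

/-- Induction follows the numeral to which `c` converts. Each case realizes the contractum and
returns to the recursor by closure under conversion. -/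
theorem realizes_natRec {φ : Ty} {σ : ℕ → Tm} {a b c : Tm} (hc : IsNum c)
    (ha : φ.Realizes (scons .zero σ) a) (hb : (natStepTy φ).Realizes σ b) :
    φ.Realizes (scons c σ) (.natRec a b c) := by
  induction hc with
  | zero h =>
    exact ha.conv (h.scons fun _ => .refl _)
      (((Conv.refl a).natRec (.refl b) h).trans (Step.natRec_zero a b).conv)
  | @succ c d h hd ih =>
    exact (realizes_natStepTy hb hd ih).conv (h.scons fun _ => .refl _)
      (((Conv.refl a).natRec (.refl b) h).trans (Step.natRec_succ a b d).conv)

theorem realizes_vecRec {ψ φ : Ty} {σ : ℕ → Tm} {a b c l : Tm} (hc : IsVec (ψ.Realizes σ) c l)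
    (ha : φ.Realizes (scons .nil (scons .zero σ)) a) (hb : (vecStepTy ψ φ).Realizes σ b) :
    φ.Realizes (scons c (scons l σ)) (.vecRec a b c) := by
  induction hc with
  | nil h hl =>
    exact ha.conv (h.scons (hl.scons fun _ => .refl _))
      (((Conv.refl a).vecRec (.refl b) h).trans (Step.vecRec_nil a b).conv)
  | @cons c l d e m h hl hd he ih =>
    exact (realizes_vecStepTy hb hd he ih).conv (h.scons (hl.scons fun _ => .refl _))
      (((Conv.refl a).vecRec (.refl b) h).trans (Step.vecRec_cons a b d e).conv)

/-- Every typable term realizes its type. -/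
theorem Typing.realizes {Γ : Ctx} {a : Tm} {φ : Ty} (h : Typing Γ a φ) {σ : ℕ → Tm}
    (hσ : Γ.Realizes σ) : φ.Realizes σ (a.subst σ) := by
  induction h generalizing σ with
  | var hn _ => exact hσ _ _ hn
  | join hab _ => exact hab.conv.subst σ
  | conv _ _ ihc iha =>
    have h := iha hσ
    rw [Ty.realizes_inst] at h ⊢
    -- The realized equation says that the two instances are convertible, so one may replace the
    -- other in the assignment.
    exact h.conv (Conv.scons (Conv.symm (ihc hσ)) fun _ => .refl _) (.refl _)
  | specAbs _ ih =>
    intro b hb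
    have h := ih (hσ.cons hb)
    -- The subject is a weakening, so the value chosen for the bound variable disappears from it.
    rw [Tm.subst_rename] at h
    exact h
  | specApp _ _ iha ihb =>
    rw [Ty.realizes_inst]
    exact iha hσ _ (ihb hσ)
  | abs _ ih =>
    intro b hb
    refine (ih (hσ.cons hb)).conv (fun _ => .refl _) ?_
    -- Extending the assignment by `b` yields exactly the contractum of the β-redex.
    rw [← Tm.inst_subst_liftSub]
    exact (Step.beta _ _).conv
  | app _ _ iha ihb =>
    rw [Ty.realizes_inst]
    exact iha hσ _ (ihb hσ)
  | zero _ => exact .zero (.refl _)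
  | nil _ => exact .nil (.refl _) (.refl _)
  | succ _ ih => exact .succ (.refl _) (ih hσ)
  | natRec _ _ _ ihc iha ihb =>
    have ha := iha hσ
    rw [Ty.realizes_inst] at ha ⊢
    exact realizes_natRec (ihc hσ) ha (ihb hσ)
  | cons _ _ iha ihb => exact .cons (.refl _) (.refl _) (iha hσ) (ihb hσ)
  | vecRec _ _ _ ihc iha ihb =>
    have ha := iha hσ
    simp only [Ty.realizes_subst, subst_scons] at ha ⊢
    exact realizes_vecRec (ihc hσ) ha (ihb hσ)

theorem not_typing_zero_eq_succ_zero (a : Tm) : ¬ Typing [] a (.eq .zero (.succ .zero)) := by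
  intro h
  -- The empty context constrains no assignment, so the identity serves.
  exact not_conv_zero_succ .zero (h.realizes (σ := .var) fun _ _ hn => nomatch hn)

end Tvec

/-- Logical soundness of unannotated `T_vec`: some type has no inhabitant in the empty context, and
in particular the type `0 = S 0` has none. -/
theorem mainTheorem6 :
    (∃ φ : Tvec.Ty, ∀ a : Tvec.Tm, ¬ Tvec.Typing [] a φ) ∧
      ∀ a : Tvec.Tm, ¬ Tvec.Typing [] a (Tvec.Ty.eq Tvec.Tm.zero (Tvec.Tm.succ Tvec.Tm.zero)) :=
  ⟨⟨_, Tvec.not_typing_zero_eq_succ_zero⟩, Tvec.not_typing_zero_eq_succ_zero⟩
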